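/- Let $n\ge 1$ and let $\mathfrak g=Q(n)$ be the complex queer Lie superalgebra of block matrices $\begin{pmatrix}A&B\\B&A\end{pmatrix}$, $A,B\in\mathrm{Mat}_n(\mathbb C)$ (even part $B=0$, odd part $A=0$), with the supercommutator as bracket. It has the basis $$e_{i,j}=\begin{pmatrix}E_{ij}&0\\0&E_{ij}\end{pmatrix},\qquad f_{i,j}=\begin{pmatrix}0&E_{ij}\\E_{ij}&0\end{pmatrix}\qquad(1\le i,j\le n).$$ Put $\mathrm{otr}\begin{pmatrix}A&B\\B&A\end{pmatrix}=\mathrm{tr}\,B$, let $E=\sum_{i=1}^{n-1}f_{i,i+1}$, and let $\chi\in\mathfrak g^*$ be the even regular nilpotent functional $\chi(x)=\mathrm{otr}(xE)$. Let $\mathfrak g=\bigoplus_d\mathfrak g_d$ be the Dynkin grading, $\mathfrak g_d=\{x:[h,x]=dx\}$, where $h=\sum_{i=1}^n(n+1-2i)e_{i,i}$, and let $\mathfrak m=\bigoplus_{j\ge1}\mathfrak g_{-2j}$. Let $I_\chi$ be the left ideal of $U(\mathfrak g)$ generated by all $a-\chi(a)$, $a\in\mathfrak m$, let $\pi:U(\mathfrak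 g)\to Q_\chi=U(\mathfrak g)/I_\chi$ be the projection, and let $W_\chi=\mathrm{End}_{U(\mathfrak g)}(Q_\chi)^{op}$ be the finite $W$-algebra. It is identified, via $w\mapsto w(\pi(1))$, with $$Q_\chi^{\mathfrak m}=\{u\in Q_\chi: au=\chi(a)u\ \text{for all } a\in\mathfrak m\},$$ with product $\pi(y_1)\pi(y_2)=\pi(y_1y_2)$. Define elements of $U(\mathfrak g)$ by $e_{i,j}^{(1)}=e_{i,j}$, $f_{i,j}^{(1)}=f_{i,j}$ and, for $m\ge 2$, $$e_{i,j}^{(m)}=\sum_{k=1}^n e_{i,k}e_{k,j}^{(m-1)}+(-1)^{m+1}\sum_{k=1}^n f_{i,k}f_{k,j}^{(m-1)},\qquad f_{i,j}^{(m)}=\sum_{k=1}^n e_{i,k}f_{k,j}^{(m-1)}+(-1)^{m+1}\sum_{k=1}^n f_{i,k}e_{k,j}^{(m-1)}.$$ Then for all odd integers $k,m$ with $n+k\ge1$ and $n+m\ge1$, the elements $\pi(e_{n,1}^{(n+k)})$ and $\pi(e_{n,1}^{(n+m)})$ lie in $W_\chi$ and commute there: $$[\pi(e_{n,1}^{(n+k)}),\pi(e_{n,1}^{(n+m)})]=0.$$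 -/

import Mathlib

noncomputable section

namespace QueerW

/-- The queer Lie superalgebra `Q(n)`: the complex block matrices `(A B; B A)`.  They form an
associative subalgebra of the `2n × 2n` matrices; the superbracket of homogeneous elements is the
supercommutator, which is used in `EnvRel` below. -/
def queer (n : ℕ) : Subalgebra ℂ (Matrix (Fin n ⊕ Fin n) (Fin n ⊕ Fin n) ℂ) where
  carrier := {X | ∃ A B : Matrix (Fin n) (Fin n) ℂ, X = Matrix.fromBlocks A B B A}
  mul_mem' := by
    rintro _ _ ⟨A, B, rfl⟩ ⟨C, D, rfl⟩
    exact ⟨A * C + B * D, A * D + B * C, by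
      rw [Matrix.fromBlocks_multiply, add_comm (B * C), add_comm (B * D)]⟩
  add_mem' := by
    rintro _ _ ⟨A, B, rfl⟩ ⟨C, D, rfl⟩
    exact ⟨A + C, B + D, by rw [Matrix.fromBlocks_add]⟩
  algebraMap_mem' := by
    intro r
    refine ⟨algebraMap ℂ _ r, 0, ?_⟩
    simp only [Matrix.algebraMap_eq_diagonal, Pi.algebraMap_def, Algebra.algebraMap_self,
      RingHom.id_apply, Matrix.fromBlocks_diagonal]
    congr 1
    ext x
    cases x <;> rfl

/-- The homogeneous part of `Q(n)` of a given parity: `(A 0; 0 A)` is even (parity `0`),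
`(0 B; B 0)` is odd (parity `1`). -/
def parityPart (n : ℕ) (p : ZMod 2) : Submodule ℂ (queer n) where
  carrier := {X | if p = 0 then X.1.toBlocks₁₂ = 0 else X.1.toBlocks₁₁ = 0}
  add_mem' := by
    intro X Y hX hY
    simp only [Set.mem_ofPred_eq] at hX hY ⊢
    split_ifs at hX hY ⊢
    · ext i j
      simpa [Matrix.toBlocks₁₂] using congrArg₂ (· + ·) (congrFun₂ hX i j) (congrFun₂ hY i j)
    · ext i j
      simpa [Matrix.toBlocks₁₁] using congrArg₂ (· + ·) (congrFun₂ hX i j) (congrFun₂ hY i j)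
  zero_mem' := by
    simp only [Set.mem_ofPred_eq]
    split_ifs <;> rfl
  smul_mem' := by
    intro c X hX
    simp only [Set.mem_ofPred_eq] at hX ⊢
    split_ifs at hX ⊢
    · ext i j
      simpa [Matrix.toBlocks₁₂] using congrArg (c * ·) (congrFun₂ hX i j)
    · ext i j
      simpa [Matrix.toBlocks₁₁] using congrArg (c * ·) (congrFun₂ hX i j)

/-- The sign `(-1)^{pq}` of two parities. -/
def sgn (p q : ZMod 2) : ℂ := (-1) ^ (p.val * q.val)

/-- The defining relations `x y - (-1)^{p(x)p(y)} y x = [x, y]` (for homogeneous `x`, `y`) of the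
universal enveloping algebra, where `[x, y]` is the supercommutator of the matrices `x`, `y`. -/
inductive EnvRel (n : ℕ) : TensorAlgebra ℂ (queer n) → TensorAlgebra ℂ (queer n) → Prop
  | bracket (p q : ZMod 2) (X Y : queer n) (hX : X ∈ parityPart n p) (hY : Y ∈ parityPart n q) :
      EnvRel n
        (TensorAlgebra.ι ℂ X * TensorAlgebra.ι ℂ Y
          - sgn p q • (TensorAlgebra.ι ℂ Y * TensorAlgebra.ι ℂ X))
        (TensorAlgebra.ι ℂ (X * Y - sgn p q • (Y * X)))

/-- The universal enveloping algebra `U(Q(n))`. -/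
def U (n : ℕ) : Type := RingQuot (EnvRel n)

instance (n : ℕ) : Ring (U n) := inferInstanceAs (Ring (RingQuot (EnvRel n)))

instance (n : ℕ) : Algebra ℂ (U n) := inferInstanceAs (Algebra ℂ (RingQuot (EnvRel n)))

/-- The quotient map from the tensor algebra. -/
def mkU (n : ℕ) : TensorAlgebra ℂ (queer n) →ₐ[ℂ] U n := RingQuot.mkAlgHom ℂ (EnvRel n)

/-- The canonical map `Q(n) → U(Q(n))`. -/
def ι (n : ℕ) : queer n →ₗ[ℂ] U n :=
  (mkU n).toLinearMap ∘ₗ TensorAlgebra.ι ℂ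

/-- The relations of `U(Q(n))`, in `U(Q(n))`. -/
theorem ι_bracket (n : ℕ) (p q : ZMod 2) (X Y : queer n) (hX : X ∈ parityPart n p)
    (hY : Y ∈ parityPart n q) :
    ι n X * ι n Y - sgn p q • (ι n Y * ι n X) = ι n (X * Y - sgn p q • (Y * X)) := by
  have key : mkU n _ = mkU n _ := RingQuot.mkAlgHom_rel ℂ (EnvRel.bracket p q X Y hX hY)
  rw [map_sub, map_smul, map_mul, map_mul] at key
  exact key

/-- The even basis element `e_{i,j}`. -/
def e (n : ℕ) (i j : Fin n) : queer n :=
  ⟨Matrix.fromBlocks (Matrix.single i j 1) 0 0 (Matrix.single i j 1), _, _, rfl⟩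

/-- The odd basis element `f_{i,j}`. -/
def f (n : ℕ) (i j : Fin n) : queer n :=
  ⟨Matrix.fromBlocks 0 (Matrix.single i j 1) (Matrix.single i j 1) 0, _, _, rfl⟩

/-- The odd trace `(A B; B A) ↦ tr B`. -/
def otr (n : ℕ) : queer n →ₗ[ℂ] ℂ where
  toFun X := X.1.toBlocks₁₂.trace
  map_add' X Y := by
    simp [Matrix.trace, Matrix.toBlocks₁₂, Finset.sum_add_distrib]
  map_smul' c X := by
    simp [Matrix.trace, Matrix.toBlocks₁₂, Finset.mul_sum]

/-- `E = ∑ f_{i,i+1}`. -/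
def E (n : ℕ) : queer n := ∑ i : Fin n, ∑ j : Fin n, if j.val = i.val + 1 then f n i j else 0

/-- The regular nilpotent functional `χ(x) = (x|E) = otr(xE)`. -/
def χ (n : ℕ) : queer n →ₗ[ℂ] ℂ := otr n ∘ₗ LinearMap.mulRight ℂ (E n)

/-- `h = diag(n-1, n-3, …, 1-n)`, as an even element of `Q(n)`. -/
def h (n : ℕ) : queer n := ∑ i : Fin n, ((n : ℂ) - 1 - 2 * (i.val : ℂ)) • e n i i

/-- The piece `𝔤_d = {x : [h, x] = d x}` of the Dynkin grading (`h` is even, so the bracket with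
`h` is the ordinary commutator). -/
def dynkinPart (n : ℕ) (d : ℤ) : Submodule ℂ (queer n) :=
  LinearMap.ker (LinearMap.mulLeft ℂ (h n) - LinearMap.mulRight ℂ (h n)
    - (d : ℂ) • LinearMap.id)

/-- `𝔪 = ⨁_{j ≥ 1} 𝔤_{-2j}`. -/
def 𝔪 (n : ℕ) : Submodule ℂ (queer n) := ⨆ j : ℕ, dynkinPart n (-2 * ((j : ℤ) + 1))

/-- The left ideal `I_χ` of `U(Q(n))` generated by `a - χ(a)`, `a ∈ 𝔪`. -/
def I (n : ℕ) : Submodule (U n) (U n) :=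
  Submodule.span (U n) {u | ∃ a ∈ 𝔪 n, u = ι n a - algebraMap ℂ (U n) (χ n a)}

/-- The generalized Whittaker module `Q_χ = U(Q(n)) / I_χ`. -/
abbrev Q (n : ℕ) : Type := U n ⧸ I n

/-- The projection `π : U(Q(n)) → U(Q(n)) / I_χ`. -/
def π (n : ℕ) : U n →ₗ[U n] Q n := (I n).mkQ

/-- The finite `W`-algebra `W_χ = End_{U(Q(n))}(Q_χ)^{op}`. -/
abbrev W (n : ℕ) : Type := (Module.End (U n) (Q n))ᵐᵒᵖ

/-- The space `Q_χ^𝔪 = {u ∈ Q_χ : a u = χ(a) u for all a ∈ 𝔪}`. -/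
def whittaker (n : ℕ) : Submodule ℂ (Q n) where
  carrier := {u | ∀ a ∈ 𝔪 n, ι n a • u = χ n a • u}
  add_mem' hu hv a ha := by rw [smul_add, smul_add, hu a ha, hv a ha]
  zero_mem' a _ := by rw [smul_zero, smul_zero]
  smul_mem' c u hu a ha := by rw [smul_comm, hu a ha, smul_comm]

theorem smul_π_one (n : ℕ) (x : U n) : x • π n 1 = π n x := by
  rw [← map_smul, smul_eq_mul, mul_one]

theorem π_one_mem (n : ℕ) : π n 1 ∈ whittaker n := by
  intro a ha
  have h1 : π n (ι n a - algebraMap ℂ (U n) (χ n a)) = 0 :=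
    (Submodule.Quotient.mk_eq_zero _).2 (Submodule.subset_span ⟨a, ha, rfl⟩)
  rw [map_sub, sub_eq_zero] at h1
  rw [smul_π_one, h1, ← smul_π_one, algebraMap_smul]

theorem I_le (n : ℕ) (u : whittaker n) : I n ≤ LinearMap.ker (LinearMap.toSpanSingleton (U n) (Q n) u) := by
  refine Submodule.span_le.2 ?_
  rintro _ ⟨a, ha, rfl⟩
  rw [SetLike.mem_coe, LinearMap.mem_ker, LinearMap.toSpanSingleton_apply, sub_smul, sub_eq_zero,
    algebraMap_smul]
  exact u.2 a ha

/-- The identification of `W_χ` with `Q_χ^𝔪`: an endomorphism `w` corresponds to `w(π(1))`. -/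
def identify (n : ℕ) : W n ≃ₗ[ℂ] whittaker n where
  toFun w := ⟨w.unop (π n 1), fun a ha => by
    rw [← map_smul, π_one_mem n a ha, LinearMap.map_smul_of_tower]⟩
  map_add' w w' := rfl
  map_smul' c w := rfl
  invFun u := MulOpposite.op ((I n).liftQ (LinearMap.toSpanSingleton (U n) (Q n) u) (I_le n u))
  left_inv w := by
    apply MulOpposite.unop_injective
    apply Submodule.linearMap_qext
    ext
    exact one_smul (U n) (w.unop (π n 1))
  right_inv u := by
    apply Subtype.ext
    exact one_smul (U n) (u : Q n)

/-- The product of `W_χ` is `π(y₁)π(y₂) = π(y₁y₂)` under this identification. -/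
theorem identify_mul (n : ℕ) (y₁ y₂ : U n) (w₁ w₂ : W n)
    (h₁ : (identify n w₁ : Q n) = π n y₁) (h₂ : (identify n w₂ : Q n) = π n y₂) :
    (identify n (w₁ * w₂) : Q n) = π n (y₁ * y₂) := by
  change w₁.unop (π n 1) = π n y₁ at h₁
  change w₂.unop (π n 1) = π n y₂ at h₂
  change w₂.unop (w₁.unop (π n 1)) = π n (y₁ * y₂)
  rw [h₁, ← smul_π_one n y₁, map_smul, h₂, ← map_smul, smul_eq_mul]

/-- The pair of families `(e_{i,j}^{(m)}, f_{i,j}^{(m)})` of Sergeev's elements of `U(Q(n))`: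
`e^{(m)}_{ij} = ∑ₖ e_{ik} e^{(m-1)}_{kj} + (-1)^{m+1} ∑ₖ f_{ik} f^{(m-1)}_{kj}` and
`f^{(m)}_{ij} = ∑ₖ e_{ik} f^{(m-1)}_{kj} + (-1)^{m+1} ∑ₖ f_{ik} e^{(m-1)}_{kj}`.
The recursion starts at `e^{(0)}_{ij} = δ_{ij}`, `f^{(0)}_{ij} = 0`, which amounts to
`e^{(1)}_{ij} = e_{ij}`, `f^{(1)}_{ij} = f_{ij}`, see `eS_one` and `fS_one`. -/
def sergeev (n : ℕ) : ℕ → (Fin n → Fin n → U n) × (Fin n → Fin n → U n)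
  | 0 => (fun i j => if i = j then 1 else 0, fun _ _ => 0)
  | m + 1 =>
    (fun i j => ∑ k, ι n (e n i k) * (sergeev n m).1 k j
        + (-1) ^ (m + 2) * ∑ k, ι n (f n i k) * (sergeev n m).2 k j,
     fun i j => ∑ k, ι n (e n i k) * (sergeev n m).2 k j
        + (-1) ^ (m + 2) * ∑ k, ι n (f n i k) * (sergeev n m).1 k j)

/-- `e_{i,j}^{(m)}`. -/
def eS (n m : ℕ) (i j : Fin n) : U n := (sergeev n m).1 i j

/-- `f_{i,j}^{(m)}`. -/
def fS (n m : ℕ) (i j : Fin n) : U n := (sergeev n m).2 i j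

theorem eS_one (n : ℕ) (i j : Fin n) : eS n 1 i j = ι n (e n i j) := by
  simp [eS, sergeev]

theorem fS_one (n : ℕ) (i j : Fin n) : fS n 1 i j = ι n (f n i j) := by
  simp [fS, sergeev]

end QueerW

end

/-! Collect Sergeev's elements into the block matrix `L = (e f; -f -e)` over `U(Q(n))`: the sign
`(-1)^{m+1}` of the recursion is absorbed, and `e^{(m)}`, `f^{(m)}` are the upper blocks of `L ^ m`.
For every generator `g` the supercommutation relations say that `L` commutes with `g · D - N`, where
`D` is a diagonal sign matrix and `N` is a numerical matrix; hence so does every power of `L`. Read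
entrywise, this gives `[L, e^{(s)}_{kl}] = [L ^ s, M]` with `M` numerical, depending on `s` only
through its parity. By the Leibniz rule `[e^{(r)}_{ij}, e^{(s)}_{ij}]` is then a sum over `a < r` of
a function of `a` that is antisymmetric under `a ↦ r + s - 1 - a`. If `r` and `s` have the same
parity, exchanging them leaves that sum unchanged and reverses the sign of the commutator. -/

namespace QueerW

open Finset Matrix

section Antisymmetry

theorem sum_range_eq_zero_of_reflect_neg {G : Type*} [AddCommGroup G] [IsAddTorsionFree G]
    {f : ℕ → G} {N : ℕ} (hf : ∀ a < N, f (N - 1 - a) = -f a) : ∑ a ∈ range N, f a = 0 := by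
  rw [← self_eq_neg, ← sum_neg_distrib]
  conv_lhs => rw [← sum_range_reflect]
  exact sum_congr rfl fun a ha => hf a (mem_range.1 ha)

theorem sum_range_eq_sum_range_of_reflect_neg {G : Type*} [AddCommGroup G] [IsAddTorsionFree G]
    {f : ℕ → G} {r s : ℕ} (hf : ∀ a < r + s, f (r + s - 1 - a) = -f a) :
    ∑ a ∈ range r, f a = ∑ a ∈ range s, f a := by
  have tail_eq : ∑ a ∈ range s, f (r + a) = -∑ a ∈ range s, f a := by
    rw [← sum_range_reflect f, ← sum_neg_distrib]
    refine sum_congr rfl fun a ha => ?_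
    have has : a < s := mem_range.1 ha
    rw [show r + a = r + s - 1 - (s - 1 - a) by omega, hf _ (by omega)]
  rw [← sub_eq_zero, sub_eq_add_neg, ← tail_eq, ← sum_range_add]
  exact sum_range_eq_zero_of_reflect_neg hf

end Antisymmetry

section Commutators

variable {A : Type*} [Ring A]

theorem lie_pow_eq_sum (x c : A) (r : ℕ) :
    ⁅x ^ r, c⁆ = ∑ a ∈ range r, x ^ a * ⁅x, c⁆ * x ^ (r - 1 - a) := by
  have telescope := sum_range_sub (fun a => x ^ a * c * x ^ (r - a)) r
  rw [Nat.sub_self, Nat.sub_zero, pow_zero, one_mul, mul_one] at telescope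
  rw [Ring.lie_def, ← telescope]
  refine sum_congr rfl fun a ha => ?_
  obtain ⟨q, rfl⟩ := Nat.exists_eq_add_of_lt (mem_range.1 ha)
  rw [show a + q + 1 - (a + 1) = q by omega, show a + q + 1 - a = q + 1 by omega,
    show a + q + 1 - 1 - a = q by omega, Ring.lie_def, pow_succ, pow_succ']
  noncomm_ring

theorem lie_pow_eq_sum_sub {x c m : A} {s : ℕ} (hc : ⁅x, c⁆ = ⁅x ^ s, m⁆) (r : ℕ) :
    ⁅x ^ r, c⁆ = ∑ a ∈ range r,
      (x ^ (r + s - 1 - a) * m * x ^ a - x ^ a * m * x ^ (r + s - 1 - a)) := by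
  rw [lie_pow_eq_sum, hc]
  simp only [Ring.lie_def, mul_sub, sub_mul, sum_sub_distrib]
  congr 1
  · rw [← sum_range_reflect]
    refine sum_congr rfl fun a ha => ?_
    obtain ⟨q, rfl⟩ := Nat.exists_eq_add_of_lt (mem_range.1 ha)
    rw [show a + q + 1 - 1 - a = q by omega, show a + q + 1 - 1 - q = a by omega,
      show a + q + 1 + s - 1 - a = q + s by omega, pow_add]
    simp only [mul_assoc]
  · refine sum_congr rfl fun a ha => ?_
    obtain ⟨q, rfl⟩ := Nat.exists_eq_add_of_lt (mem_range.1 ha)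
    rw [show a + q + 1 - 1 - a = q by omega, show a + q + 1 + s - 1 - a = s + q by omega, pow_add]
    simp only [mul_assoc]

theorem lie_pow_eq_lie_pow {g m x : A} (hx : ⁅g, x⁆ = ⁅m, x⁆) (s : ℕ) :
    ⁅g, x ^ s⁆ = ⁅m, x ^ s⁆ := by
  have hcomm : Commute (g - m) x := by
    rwa [Commute, SemiconjBy, sub_mul, mul_sub, sub_eq_sub_iff_sub_eq_sub]
  have hpow := (hcomm.pow_right s).eq
  rwa [sub_mul, mul_sub, sub_eq_sub_iff_sub_eq_sub] at hpow

theorem lie_scalar_apply {κ : Type*} [Fintype κ] [DecidableEq κ] (X : Matrix κ κ A) (c : A)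
    (i j : κ) : ⁅X, scalar κ c⁆ i j = ⁅X i j, c⁆ := by
  simp only [Ring.lie_def, scalar_apply, Matrix.sub_apply, mul_diagonal, diagonal_mul]

theorem commute_pow_apply [IsAddTorsionFree A] {κ : Type*} [Fintype κ] [DecidableEq κ]
    {L M : Matrix κ κ A} {i j : κ} {r s : ℕ}
    (hr : ⁅L, scalar κ ((L ^ r) i j)⁆ = ⁅L ^ r, M⁆)
    (hs : ⁅L, scalar κ ((L ^ s) i j)⁆ = ⁅L ^ s, M⁆) :
    Commute ((L ^ r) i j) ((L ^ s) i j) := by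
  let F (a : ℕ) : A :=
    (L ^ (r + s - 1 - a) * M * L ^ a - L ^ a * M * L ^ (r + s - 1 - a)) i j
  have lie_rs : ⁅(L ^ r) i j, (L ^ s) i j⁆ = ∑ a ∈ range r, F a := by
    rw [← lie_scalar_apply, lie_pow_eq_sum_sub hs, Matrix.sum_apply]
  have lie_sr : ⁅(L ^ s) i j, (L ^ r) i j⁆ = ∑ a ∈ range s, F a := by
    rw [← lie_scalar_apply, lie_pow_eq_sum_sub hr, Matrix.sum_apply, add_comm s r]
  have reflect : ∀ a < r + s, F (r + s - 1 - a) = -F a := by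
    intro a ha
    simp only [F, show r + s - 1 - (r + s - 1 - a) = a by omega, ← Matrix.neg_apply, neg_sub]
  have lie_eq_neg : ⁅(L ^ r) i j, (L ^ s) i j⁆ = -⁅(L ^ r) i j, (L ^ s) i j⁆ := by
    conv_lhs => rw [lie_rs, sum_range_eq_sum_range_of_reflect_neg reflect, ← lie_sr]
    rw [Ring.lie_def, Ring.lie_def, neg_sub]
  exact commute_iff_lie_eq.2 (self_eq_neg.1 lie_eq_neg)

end Commutators

section Single

variable {R κ : Type*} [NonUnitalNonAssocSemiring R] [Fintype κ] [DecidableEq κ]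

theorem single_mul_apply_eq_ite (i j k l : κ) (c : R) (X : Matrix κ κ R) :
    (single j i c * X) k l = if j = k then c * X i l else 0 := by
  simp [mul_apply, single_apply, ite_and]

theorem mul_single_apply_eq_ite (i j k l : κ) (c : R) (X : Matrix κ κ R) :
    (X * single j i c) k l = if i = l then X k j * c else 0 := by
  simp [mul_apply, single_apply, ite_and]

end Single

/-- The relations of `U(Q(n))` for matrices `x` and `y` of elements of a ring, in the roles of the
even generators `e_{i,j}` and the odd generators `f_{i,j}`. -/
structure QueerRelations {R κ : Type*} [Ring R] [DecidableEq κ] (x y : Matrix κ κ R) : Prop where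
  lie_even_even (i j k l : κ) :
    ⁅x i j, x k l⁆ = (if j = k then x i l else 0) - if i = l then x k j else 0
  lie_even_odd (i j k l : κ) :
    ⁅x i j, y k l⁆ = (if j = k then y i l else 0) - if i = l then y k j else 0
  odd_mul_odd_add (i j k l : κ) :
    y i j * y k l + y k l * y i j = (if j = k then x i l else 0) + if i = l then x k j else 0

/-- The block matrix `L = (x y; -y -x)`. For the generators of `Q(n)` the upper blocks of `L ^ m`
are Sergeev's elements `e^{(m)}` and `f^{(m)}`; the signs of the lower blocks produce the
alternating sign of Sergeev's recursion. -/
def sergeevMatrix {R κ : Type*} [Neg R] (x y : Matrix κ κ R) : Matrix (κ ⊕ κ) (κ ⊕ κ) R :=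
  fromBlocks x y (-y) (-x)

section SergeevMatrix

variable {R κ : Type*} [Ring R] [Fintype κ] [DecidableEq κ] (x y : Matrix κ κ R)

theorem sergeevMatrix_pow_swap (m : ℕ) (p q : κ ⊕ κ) :
    (sergeevMatrix x y ^ m) p.swap q.swap = (-1) ^ m * (sergeevMatrix x y ^ m) p q := by
  have submatrix_swap : (sergeevMatrix x y).submatrix Sum.swap Sum.swap = -sergeevMatrix x y := by
    simp only [sergeevMatrix, fromBlocks_submatrix_sum_swap_sum_swap, fromBlocks_neg, neg_neg]
  have pow_submatrix : (sergeevMatrix x y ^ m).submatrix Sum.swap Sum.swap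
      = (-sergeevMatrix x y) ^ m := by
    rw [← submatrix_swap]
    exact map_pow (reindexRingEquiv R (Equiv.sumComm κ κ)) _ m
  have := congrFun₂ pow_submatrix p q
  rcases m.even_or_odd with hm | hm <;> simpa [hm.neg_pow, hm.neg_one_pow] using this

end SergeevMatrix

namespace QueerRelations

variable {R κ : Type*} [Ring R] [DecidableEq κ] {x y : Matrix κ κ R}

theorem lie_odd_even (hxy : QueerRelations x y) (i j k l : κ) :
    ⁅y i j, x k l⁆ = (if j = k then y i l else 0) - if i = l then y k j else 0 := by
  rw [Ring.lie_def, ← neg_sub, ← Ring.lie_def, hxy.lie_even_odd, neg_sub]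
  simp only [eq_comm]

variable [Fintype κ]

theorem lie_even_sergeevMatrix (hxy : QueerRelations x y) (i j : κ) :
    ⁅fromBlocks (scalar κ (x i j)) 0 0 (scalar κ (x i j)), sergeevMatrix x y⁆
      = ⁅fromBlocks (single j i (1 : R)) 0 0 (single j i 1), sergeevMatrix x y⁆ := by
  have even_even : ⁅scalar κ (x i j), x⁆ = ⁅single j i (1 : R), x⁆ := by
    ext k l
    simpa only [Ring.lie_def, Matrix.sub_apply, scalar_apply, diagonal_mul, mul_diagonal,
      single_mul_apply_eq_ite, mul_single_apply_eq_ite, one_mul, mul_one]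
      using hxy.lie_even_even i j k l
  have even_odd : ⁅scalar κ (x i j), y⁆ = ⁅single j i (1 : R), y⁆ := by
    ext k l
    simpa only [Ring.lie_def, Matrix.sub_apply, scalar_apply, diagonal_mul, mul_diagonal,
      single_mul_apply_eq_ite, mul_single_apply_eq_ite, one_mul, mul_one]
      using hxy.lie_even_odd i j k l
  simp only [Ring.lie_def, sergeevMatrix, fromBlocks_multiply, sub_eq_add_neg, fromBlocks_neg,
    fromBlocks_add, zero_mul, mul_zero, neg_zero, add_zero, zero_add, mul_neg, neg_mul, ← neg_add]
    at even_even even_odd ⊢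
  rw [even_even, even_odd]

theorem lie_odd_sergeevMatrix (hxy : QueerRelations x y) (i j : κ) :
    ⁅fromBlocks (scalar κ (y i j)) 0 0 (-scalar κ (y i j)), sergeevMatrix x y⁆
      = ⁅fromBlocks 0 (-single j i (1 : R)) (single j i 1) 0, sergeevMatrix x y⁆ := by
  have odd_even : scalar κ (y i j) * x - x * scalar κ (y i j)
      = single j i (1 : R) * y - y * single j i 1 := by
    ext k l
    simpa only [Ring.lie_def, Matrix.sub_apply, scalar_apply, diagonal_mul, mul_diagonal,
      single_mul_apply_eq_ite, mul_single_apply_eq_ite, one_mul, mul_one]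
      using hxy.lie_odd_even i j k l
  have odd_odd : scalar κ (y i j) * y + y * scalar κ (y i j)
      = single j i (1 : R) * x + x * single j i 1 := by
    ext k l
    simpa only [Matrix.add_apply, scalar_apply, diagonal_mul, mul_diagonal,
      single_mul_apply_eq_ite, mul_single_apply_eq_ite, one_mul, mul_one]
      using hxy.odd_mul_odd_add i j k l
  simp only [Ring.lie_def, sergeevMatrix, fromBlocks_multiply, sub_eq_add_neg, fromBlocks_neg,
    fromBlocks_add, zero_mul, mul_zero, neg_zero, add_zero, zero_add, mul_neg, neg_mul, neg_neg]
    at odd_even odd_odd ⊢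
  rw [odd_even, odd_odd]

theorem lie_even_sergeevMatrix_pow_apply (hxy : QueerRelations x y) (s : ℕ) (i j k l : κ) :
    ⁅x i j, (sergeevMatrix x y ^ s) (.inl k) (.inl l)⁆
      = (if j = k then (sergeevMatrix x y ^ s) (.inl i) (.inl l) else 0)
        - if i = l then (sergeevMatrix x y ^ s) (.inl k) (.inl j) else 0 := by
  have lie_pow := lie_pow_eq_lie_pow (hxy.lie_even_sergeevMatrix i j) s
  rw [← fromBlocks_toBlocks (sergeevMatrix x y ^ s)] at lie_pow ⊢
  simp only [Ring.lie_def, fromBlocks_multiply, zero_mul, mul_zero, add_zero, zero_add] at lie_pow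
  have := congrFun₂ lie_pow (.inl k) (.inl l)
  simpa only [Ring.lie_def, Matrix.sub_apply, fromBlocks_apply₁₁, scalar_apply, diagonal_mul,
    mul_diagonal, single_mul_apply_eq_ite, mul_single_apply_eq_ite, one_mul, mul_one] using this

theorem lie_odd_sergeevMatrix_pow_apply (hxy : QueerRelations x y) (s : ℕ) (i j k l : κ) :
    ⁅y i j, (sergeevMatrix x y ^ s) (.inl k) (.inl l)⁆
      = -(if j = k then (sergeevMatrix x y ^ s) (.inr i) (.inl l) else 0)
        - if i = l then (sergeevMatrix x y ^ s) (.inl k) (.inr j) else 0 := by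
  have lie_pow := lie_pow_eq_lie_pow (hxy.lie_odd_sergeevMatrix i j) s
  rw [← fromBlocks_toBlocks (sergeevMatrix x y ^ s)] at lie_pow ⊢
  simp only [Ring.lie_def, fromBlocks_multiply, zero_mul, mul_zero, add_zero, zero_add, neg_mul]
    at lie_pow
  have := congrFun₂ lie_pow (.inl k) (.inl l)
  simpa only [Ring.lie_def, Matrix.sub_apply, Matrix.neg_apply, fromBlocks_apply₁₁,
    fromBlocks_apply₁₂, fromBlocks_apply₂₁, scalar_apply, diagonal_mul,
    mul_diagonal, single_mul_apply_eq_ite, mul_single_apply_eq_ite, one_mul, mul_one] using this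

theorem lie_sergeevMatrix_scalar_pow_apply (hxy : QueerRelations x y) (s : ℕ) (k l : κ) :
    ⁅sergeevMatrix x y, scalar (κ ⊕ κ) ((sergeevMatrix x y ^ s) (.inl k) (.inl l))⁆
      = ⁅sergeevMatrix x y ^ s,
          fromBlocks (single l k (1 : R)) 0 0 (single l k ((-1) ^ (s + 1)))⁆ := by
  -- The sign `(-1) ^ (s + 1)` comes from the upper right block: there `[y, ·]` involves the lower
  -- left block of `L ^ s`, which is `(-1) ^ s` times its upper right block.
  have even (i j : κ) := hxy.lie_even_sergeevMatrix_pow_apply s i j k l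
  have odd (i j : κ) := hxy.lie_odd_sergeevMatrix_pow_apply s i j k l
  have swap₂₁ (i j : κ) : (sergeevMatrix x y ^ s) (.inr i) (.inl j)
      = (-1) ^ s * (sergeevMatrix x y ^ s) (.inl i) (.inr j) :=
    sergeevMatrix_pow_swap x y s (.inl i) (.inr j)
  have swap₂₂ (i j : κ) : (sergeevMatrix x y ^ s) (.inr i) (.inr j)
      = (-1) ^ s * (sergeevMatrix x y ^ s) (.inl i) (.inl j) :=
    sergeevMatrix_pow_swap x y s (.inl i) (.inl j)
  generalize sergeevMatrix x y ^ s = P at even odd swap₂₁ swap₂₂ ⊢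
  have neg_lie (a b : R) : ⁅-a, b⁆ = -⁅a, b⁆ := by
    simp only [Ring.lie_def, neg_mul, mul_neg, neg_sub_neg, neg_sub]
  ext (i | i) (j | j) <;> rw [lie_scalar_apply, ← fromBlocks_toBlocks P] <;>
  rcases s.even_or_odd with hs | hs <;>
  simp only [sergeevMatrix, fromBlocks_apply₁₁, fromBlocks_apply₁₂, fromBlocks_apply₂₁,
    fromBlocks_apply₂₂, Matrix.neg_apply, neg_lie, even, odd, swap₂₁, swap₂₂,
    Ring.lie_def (fromBlocks _ _ _ _), fromBlocks_multiply, Matrix.sub_apply, Matrix.mul_zero,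
    Matrix.zero_mul, add_zero, zero_add, single_mul_apply_eq_ite, mul_single_apply_eq_ite,
    hs.neg_one_pow, hs.add_one.neg_one_pow, toBlocks₁₁, toBlocks₁₂, toBlocks₂₁, toBlocks₂₂,
    of_apply, one_mul, mul_one, neg_one_mul, mul_neg_one, eq_comm (a := i), eq_comm (a := j)] <;>
  split_ifs <;> abel

theorem commute_sergeevMatrix_pow_apply [IsAddTorsionFree R] (hxy : QueerRelations x y) {r s : ℕ}
    (hrs : Even (r + s)) (i j : κ) :
    Commute ((sergeevMatrix x y ^ r) (.inl i) (.inl j))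
      ((sergeevMatrix x y ^ s) (.inl i) (.inl j)) := by
  have sign_eq : (-1 : R) ^ r = (-1) ^ s := neg_one_pow_congr (Nat.even_add.1 hrs)
  refine commute_pow_apply (hxy.lie_sergeevMatrix_scalar_pow_apply r i j) ?_
  rw [pow_succ, sign_eq, ← pow_succ]
  exact hxy.lie_sergeevMatrix_scalar_pow_apply s i j

end QueerRelations

section Generators

variable (n : ℕ)

/-- The matrix of the even generators `e_{i,j}` of `U(Q(n))`. -/
noncomputable def evenGenerators : Matrix (Fin n) (Fin n) (U n) := of fun i j => ι n (e n i j)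

/-- The matrix of the odd generators `f_{i,j}` of `U(Q(n))`. -/
noncomputable def oddGenerators : Matrix (Fin n) (Fin n) (U n) := of fun i j => ι n (f n i j)

theorem e_mem_parityPart (i j : Fin n) : e n i j ∈ parityPart n 0 := rfl

theorem f_mem_parityPart (i j : Fin n) : f n i j ∈ parityPart n 1 := rfl

theorem e_mul_e (i j k l : Fin n) : e n i j * e n k l = if j = k then e n i l else 0 := by
  apply Subtype.ext
  split_ifs with hjk <;> simp [e, fromBlocks_multiply, hjk]

theorem e_mul_f (i j k l : Fin n) : e n i j * f n k l = if j = k then f n i l else 0 := by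
  apply Subtype.ext
  split_ifs with hjk <;> simp [e, f, fromBlocks_multiply, hjk]

theorem f_mul_e (i j k l : Fin n) : f n i j * e n k l = if j = k then f n i l else 0 := by
  apply Subtype.ext
  split_ifs with hjk <;> simp [e, f, fromBlocks_multiply, hjk]

theorem f_mul_f (i j k l : Fin n) : f n i j * f n k l = if j = k then e n i l else 0 := by
  apply Subtype.ext
  split_ifs with hjk <;> simp [e, f, fromBlocks_multiply, hjk]

theorem queerRelations_generators : QueerRelations (evenGenerators n) (oddGenerators n) where
  lie_even_even i j k l := by
    have bracket := ι_bracket n 0 0 _ _ (e_mem_parityPart n i j) (e_mem_parityPart n k l)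
    rw [show sgn 0 0 = 1 by simp [sgn], one_smul, one_smul, e_mul_e, e_mul_e, map_sub,
      apply_ite (ι n), apply_ite (ι n), map_zero] at bracket
    simpa only [evenGenerators, oddGenerators, of_apply, Ring.lie_def, eq_comm (a := l)]
      using bracket
  lie_even_odd i j k l := by
    have bracket := ι_bracket n 0 1 _ _ (e_mem_parityPart n i j) (f_mem_parityPart n k l)
    rw [show sgn 0 1 = 1 by simp [sgn], one_smul, one_smul, e_mul_f, f_mul_e, map_sub,
      apply_ite (ι n), apply_ite (ι n), map_zero] at bracket
    simpa only [evenGenerators, oddGenerators, of_apply, Ring.lie_def, eq_comm (a := l)]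
      using bracket
  odd_mul_odd_add i j k l := by
    have bracket := ι_bracket n 1 1 _ _ (f_mem_parityPart n i j) (f_mem_parityPart n k l)
    rw [show sgn 1 1 = -1 by simp [sgn, ZMod.val_one], neg_one_smul, neg_one_smul,
      sub_neg_eq_add, sub_neg_eq_add, f_mul_f, f_mul_f, map_add, apply_ite (ι n),
      apply_ite (ι n), map_zero] at bracket
    simpa only [evenGenerators, oddGenerators, of_apply, Ring.lie_def, eq_comm (a := l)]
      using bracket

theorem sergeevMatrix_generators_pow_inl (m : ℕ) (i j : Fin n) :
    (sergeevMatrix (evenGenerators n) (oddGenerators n) ^ m) (.inl i) (.inl j) = eS n m i j ∧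
      (sergeevMatrix (evenGenerators n) (oddGenerators n) ^ m) (.inl i) (.inr j) = fS n m i j := by
  induction m generalizing i j with
  | zero => simp [eS, fS, sergeev, one_apply]
  | succ m ih =>
    have inr_inl (k : Fin n) : (sergeevMatrix (evenGenerators n) (oddGenerators n) ^ m)
        (.inr k) (.inl j) = (-1) ^ (m + 2) * fS n m k j := by
      rw [← (ih k j).2, pow_add, neg_one_sq, mul_one]
      exact sergeevMatrix_pow_swap _ _ m (.inl k) (.inr j)
    have inr_inr (k : Fin n) : (sergeevMatrix (evenGenerators n) (oddGenerators n) ^ m)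
        (.inr k) (.inr j) = (-1) ^ (m + 2) * eS n m k j := by
      rw [← (ih k j).1, pow_add, neg_one_sq, mul_one]
      exact sergeevMatrix_pow_swap _ _ m (.inl k) (.inl j)
    have sign_comm (u v : U n) : u * ((-1) ^ (m + 2) * v) = (-1) ^ (m + 2) * (u * v) := by
      rw [← mul_assoc, ((Commute.neg_one_right u).pow_right _).eq, mul_assoc]
    rw [pow_succ', mul_apply, mul_apply, Fintype.sum_sum_type, Fintype.sum_sum_type]
    simp only [inr_inl, inr_inr, ih, sign_comm, ← mul_sum]
    exact ⟨rfl, rfl⟩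

theorem commute_eS {r s : ℕ} (hrs : Even (r + s)) (i j : Fin n) :
    Commute (eS n r i j) (eS n s i j) := by
  have : IsAddTorsionFree (U n) := .of_isTorsionFree ℂ (U n)
  rw [← (sergeevMatrix_generators_pow_inl n r i j).1,
    ← (sergeevMatrix_generators_pow_inl n s i j).1]
  exact (queerRelations_generators n).commute_sergeevMatrix_pow_apply hrs i j

end Generators

section Whittaker

variable {n : ℕ}

theorem coe_h :
    (h n).1 = diagonal fun p => (n : ℂ) - 1 - 2 * ((p.elim id id : Fin n) : ℕ) := by
  ext (i | i) (j | j) <;>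
    simp [h, e, Matrix.sum_apply, single_apply, diagonal_apply, ite_and]

theorem apply_eq_zero_of_mem_dynkinPart {d : ℤ} {X : queer n} (hX : X ∈ dynkinPart n d)
    {p q : Fin n ⊕ Fin n}
    (hpq : 2 * (((q.elim id id : Fin n) : ℤ) - ((p.elim id id : Fin n) : ℕ)) ≠ d) :
    X.1 p q = 0 := by
  have bracket : (h n).1 * X.1 - X.1 * (h n).1 - (d : ℂ) • X.1 = 0 := congrArg Subtype.val hX
  rw [coe_h] at bracket
  have entry := congrFun₂ bracket p q
  simp only [Matrix.sub_apply, diagonal_mul, mul_diagonal, Matrix.smul_apply, smul_eq_mul,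
    Matrix.zero_apply] at entry
  have weight_ne :
      2 * (((q.elim id id : Fin n) : ℂ) - ((p.elim id id : Fin n) : ℕ)) - d ≠ 0 := by
    rw [sub_ne_zero]
    exact_mod_cast hpq
  exact (mul_eq_zero.1 (by linear_combination entry)).resolve_left weight_ne

theorem eq_sum_smul_e_add_smul_f (X : queer n) :
    X = ∑ i, ∑ j, (X.1 (.inl i) (.inl j) • e n i j + X.1 (.inl i) (.inr j) • f n i j) := by
  obtain ⟨_, A, B, rfl⟩ := X
  apply Subtype.ext
  ext (i | i) (j | j) <;> simp [e, f, Matrix.sum_apply, single_apply, ite_and]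

theorem 𝔪_le_span :
    𝔪 n ≤ Submodule.span ℂ {X | ∃ i j : Fin n, j < i ∧ (X = e n i j ∨ X = f n i j)} := by
  refine iSup_le fun d X hX => ?_
  rw [eq_sum_smul_e_add_smul_f X]
  refine Submodule.sum_mem _ fun i _ => Submodule.sum_mem _ fun j _ => ?_
  rcases lt_or_ge j i with hij | hij
  · exact Submodule.add_mem _
      (Submodule.smul_mem _ _ (Submodule.subset_span ⟨i, j, hij, .inl rfl⟩))
      (Submodule.smul_mem _ _ (Submodule.subset_span ⟨i, j, hij, .inr rfl⟩))
  · have weight_ne : 2 * ((j : ℤ) - (i : ℕ)) ≠ -2 * ((d : ℤ) + 1) := by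
      rw [Fin.le_def] at hij
      omega
    rw [apply_eq_zero_of_mem_dynkinPart hX (p := .inl i) (q := .inl j) weight_ne,
      apply_eq_zero_of_mem_dynkinPart hX (p := .inl i) (q := .inr j) weight_ne,
      zero_smul, zero_smul, add_zero]
    exact Submodule.zero_mem _

theorem commute_ι_eS {i j : Fin n} (hi : IsTop i) (hj : IsBot j) (m : ℕ) {a : queer n}
    (ha : a ∈ 𝔪 n) : Commute (ι n a) (eS n m i j) := by
  rw [← (sergeevMatrix_generators_pow_inl n m i j).1]
  replace ha := 𝔪_le_span ha
  induction ha using Submodule.span_induction with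
  | mem a ha =>
    obtain ⟨k, l, hlk, rfl | rfl⟩ := ha
    all_goals
      have hli : l ≠ i := (hlk.trans_le (hi k)).ne
      have hkj : k ≠ j := ((hj l).trans_lt hlk).ne'
      rw [commute_iff_lie_eq]
    · refine ((queerRelations_generators n).lie_even_sergeevMatrix_pow_apply m k l i j).trans ?_
      rw [if_neg hli, if_neg hkj, sub_zero]
    · refine ((queerRelations_generators n).lie_odd_sergeevMatrix_pow_apply m k l i j).trans ?_
      rw [if_neg hli, if_neg hkj, neg_zero, sub_zero]
  | zero => rw [map_zero]; exact Commute.zero_left _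
  | add a b _ _ iha ihb => rw [map_add]; exact iha.add_left ihb
  | smul c a _ iha => rw [map_smul]; exact iha.smul_left c

theorem π_mem_whittaker {u : U n} (hu : ∀ a ∈ 𝔪 n, Commute (ι n a) u) : π n u ∈ whittaker n := by
  intro a ha
  rw [← map_smul, smul_eq_mul, (hu a ha).eq, ← smul_eq_mul, map_smul, ← smul_π_one n (ι n a),
    π_one_mem n a ha, smul_comm, smul_π_one]

theorem π_eS_mem_whittaker {i j : Fin n} (hi : IsTop i) (hj : IsBot j) (m : ℕ) :
    π n (eS n m i j) ∈ whittaker n :=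
  π_mem_whittaker fun _ ha => commute_ι_eS hi hj m ha

theorem lie_identify_symm_eq_zero {u v : U n} (hu : π n u ∈ whittaker n)
    (hv : π n v ∈ whittaker n) (huv : Commute u v) :
    ⁅(identify n).symm ⟨π n u, hu⟩, (identify n).symm ⟨π n v, hv⟩⁆ = 0 := by
  have identify_symm {w : U n} (hw : π n w ∈ whittaker n) :
      (identify n ((identify n).symm ⟨π n w, hw⟩) : Q n) = π n w := by
    rw [LinearEquiv.apply_symm_apply]
  apply (identify n).injective
  apply Subtype.ext
  rw [Ring.lie_def, map_sub, map_zero, Submodule.coe_sub,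
    identify_mul n u v _ _ (identify_symm hu) (identify_symm hv),
    identify_mul n v u _ _ (identify_symm hv) (identify_symm hu), huv.eq, sub_self,
    Submodule.coe_zero]

end Whittaker

end QueerW

theorem mainTheorem12_general (n : ℕ) (hn : 1 ≤ n) (r s : ℕ) (hrs : Even (r + s)) :
    ∃ (her : QueerW.π n (QueerW.eS n r ⟨n - 1, by omega⟩ ⟨0, by omega⟩) ∈ QueerW.whittaker n)
      (hes : QueerW.π n (QueerW.eS n s ⟨n - 1, by omega⟩ ⟨0, by omega⟩) ∈ QueerW.whittaker n),
      ⁅(QueerW.identify n).symm ⟨_, her⟩, (QueerW.identify n).symm ⟨_, hes⟩⁆ = 0 := by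
  have last_isTop : IsTop (⟨n - 1, by omega⟩ : Fin n) :=
    fun i => Fin.le_def.2 (Nat.le_sub_one_of_lt i.2)
  have zero_isBot : IsBot (⟨0, by omega⟩ : Fin n) := fun i => Fin.le_def.2 (Nat.zero_le i)
  exact ⟨QueerW.π_eS_mem_whittaker last_isTop zero_isBot r,
    QueerW.π_eS_mem_whittaker last_isTop zero_isBot s,
    QueerW.lie_identify_symm_eq_zero _ _ (QueerW.commute_eS n hrs _ _)⟩

theorem mainTheorem12 (n : ℕ) (hn : 1 ≤ n) (k m : ℤ) (hk : Odd k) (hm : Odd m)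
    (hnk : 1 ≤ (n : ℤ) + k) (hnm : 1 ≤ (n : ℤ) + m) :
    ∃ (hek : QueerW.π n (QueerW.eS n ((n : ℤ) + k).toNat ⟨n - 1, by omega⟩ ⟨0, by omega⟩)
          ∈ QueerW.whittaker n)
      (hem : QueerW.π n (QueerW.eS n ((n : ℤ) + m).toNat ⟨n - 1, by omega⟩ ⟨0, by omega⟩)
          ∈ QueerW.whittaker n),
      ⁅(QueerW.identify n).symm ⟨_, hek⟩, (QueerW.identify n).symm ⟨_, hem⟩⁆ = 0 := by
  have even_add : Even (((n : ℤ) + k).toNat + ((n : ℤ) + m).toNat) := by grind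
  exact mainTheorem12_general n hn _ _ even_add
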